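/- Let $F$ be a field, let $r\geq 1$ be an integer and let $m=2r$. Let $UT_m(F)$ be the algebra of upper triangular $m\times m$ matrices over $F$ and let $e_1,\dots,e_r$ be the standard basis of $G=\mathbb{Z}^r$. The \emph{finest grading} on $UT_m(F)$ is the $G$-grading in which, for $(g_1,\dots,g_m)=(e_1,\dots,e_r,0,e_r-e_{r-1},\dots,e_r-e_1)$, the matrix unit $e_{ij}$ ($i\leq j$) is homogeneous of degree $g_i-g_j$. The \emph{symplectic involution} is $A^{s}=DA^{\ast}D^{-1}$, where $\ast$ is the linear map with $e_{ij}^{\ast}=e_{m+1-j,\,m+1-i}$ and $D=\mathrm{diag}(I_r,-I_r)$; it preserves the homogeneous components. Let $F\langle X\rangle$ be the free algebra on the indeterminates $x_{i,g},x_{i,g}^{\ast}$ ($i\in\mathbb{N}$, $g\in G$). For $n\geq 0$ let $P_n^{G,\ast}$ be the span of the monomials $x_{\sigma(1),h_1}^{\delta_1}\cdots x_{\sigma(n),h_n}^{\delta_n}$ with $\sigma\in S_n$, $h_1,\dots,h_n\in G$ and each $\delta_i\in\{\emptyset,\ast\}$. Let $T_{G,\ast}$ be the set of $f\in F\langle X\rangle$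 which vanish under every substitution $x_{i,g}\mapsto a_{i,g}$, $x_{i,g}^{\ast}\mapsto a_{i,g}^{s}$ in which each $a_{i,g}\in UT_m(F)$ lies in the homogeneous component of degree $g$. Put $c_n^{G,\ast}=\dim_F P_n^{G,\ast}/(P_n^{G,\ast}\cap T_{G,\ast})$. Then every $c_n^{G,\ast}$ is finite, and there is a constant $C>0$ such that $$c_n^{G,\ast}\sim C\,n^{2r-1}(2r)^n\qquad (n\to\infty).$$ In particular, the $(G,\ast)$-exponent $\lim_{n\to\infty}\sqrt[n]{c_n^{G,\ast}}$ exists and equals $2r$. -/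

import Mathlib

open Filter Topology Asymptotics
open scoped DirectSum

noncomputable section

/-! ## Graded involutions and `(G,∗)`-codimensions (the group `G` is written additively) -/

/-- A graded involution on the `G`-graded `F`-algebra `A = ⨁ g, 𝒜 g`: an `F`-linear map which squares to the
identity, reverses products, and preserves every homogeneous component. -/
structure GradedInvolution {F A G : Type*} [Field F] [Ring A] [Algebra F A] [AddGroup G]
    [DecidableEq G] (𝒜 : G → Submodule F A) [GradedAlgebra 𝒜] where
  toLinearMap : A →ₗ[F] A
  involutive : ∀ a, toLinearMap (toLinearMap a) = a
  map_mul : ∀ a b, toLinearMap (a * b) = toLinearMap b * toLinearMap a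
  map_mem : ∀ g, ∀ a ∈ 𝒜 g, toLinearMap a ∈ 𝒜 g

/-- The free generators: `⟨i, g, false⟩` is the indeterminate `x_{i,g}` and `⟨i, g, true⟩` is `x_{i,g}^∗`. -/
@[ext]
structure StarVar (G : Type*) where
  idx : ℕ
  deg : G
  starred : Bool

/-- The free algebra `F⟨X_G, ∗⟩` on all the `x_{i,g}` and `x_{i,g}^∗`. -/
abbrev FreeStarAlgebra (F G : Type*) [Field F] : Type _ := FreeAlgebra F (StarVar G)

section Codimension

variable {F A G : Type*} [Field F] [Ring A] [Algebra F A] [AddGroup G] [DecidableEq G]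
  {𝒜 : G → Submodule F A} [GradedAlgebra 𝒜]

/-- The evaluation homomorphism `x_{i,g} ↦ a i g`, `x_{i,g}^∗ ↦ (a i g)^∗`. -/
def starEval (s : GradedInvolution 𝒜) (a : ℕ → G → A) : FreeStarAlgebra F G →ₐ[F] A :=
  FreeAlgebra.lift F fun v =>
    if v.starred then s.toLinearMap (a v.idx v.deg) else a v.idx v.deg

/-- The `(G,∗)`-identities of `A`: the polynomials which vanish whenever each `x_{i,g}` is replaced
by an element of `𝒜 g`. -/
def starIdentities (s : GradedInvolution 𝒜) : Submodule F (FreeStarAlgebra F G) where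
  carrier := {f | ∀ a : ℕ → G → A, (∀ i g, a i g ∈ 𝒜 g) → starEval s a f = 0}
  add_mem' := fun {f h} hf hh a ha => by rw [map_add, hf a ha, hh a ha, add_zero]
  zero_mem' := fun a _ => map_zero _
  smul_mem' := fun c f hf a ha => by rw [map_smul, hf a ha, smul_zero]

variable (F G) in
/-- The multilinear polynomials `P_n^{G,∗}`: the span of the monomials
`x_{σ(1),g_1}^{δ_1} ⋯ x_{σ(n),g_n}^{δ_n}` (with indices `0, …, n - 1` in place of `1, …, n`). -/
def multilinearPart (n : ℕ) : Submodule F (FreeStarAlgebra F G) :=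
  Submodule.span F
    {w | ∃ (σ : Equiv.Perm (Fin n)) (g : Fin n → G) (δ : Fin n → Bool),
      w = (List.ofFn fun k => FreeAlgebra.ι F (⟨(σ k : ℕ), g k, δ k⟩ : StarVar G)).prod}

/-- `P_n^{G,∗}(A) = P_n^{G,∗} / (P_n^{G,∗} ∩ T_{G,∗}(A))`. -/
abbrev relMultilinear (s : GradedInvolution 𝒜) (n : ℕ) : Type _ :=
  multilinearPart F G n ⧸ (starIdentities s).submoduleOf (multilinearPart F G n)

/-- The `n`-th `(G,∗)`-codimension `c_n^{G,∗}(A)`. -/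
def starCodim (s : GradedInvolution 𝒜) (n : ℕ) : ℕ :=
  Module.finrank F (relMultilinear s n)

/-- The `(G,∗)`-exponent of `A` exists and equals `e`, i.e. `(c_n^{G,∗}(A))^{1/n} → e`. -/
def HasStarExponent (s : GradedInvolution 𝒜) (e : ℝ) : Prop :=
  Tendsto (fun n : ℕ => (starCodim s n : ℝ) ^ (1 / (n : ℝ))) atTop (𝓝 e)

end Codimension

/-! ## Upper triangular matrices and elementary gradings -/

/-- The algebra `UT_m(F)` of upper triangular `m × m` matrices. -/
def UT (F : Type*) [Field F] (m : ℕ) : Subalgebra F (Matrix (Fin m) (Fin m) F) where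
  carrier := {M | M.BlockTriangular id}
  mul_mem' := fun ha hb => ha.mul hb
  add_mem' := fun ha hb => ha.add hb
  algebraMap_mem' := fun c => by
    rw [Matrix.algebraMap_eq_diagonal]; exact Matrix.blockTriangular_diagonal _

section Elementary

variable (F : Type*) [Field F] {m : ℕ} {G : Type*} [AddGroup G] [DecidableEq G]

/-- The elementary grading induced by the tuple `t`: the matrix unit `e_{ij}` has degree `t i - t j`. -/
def elementaryGrading (t : Fin m → G) (g : G) : Submodule F (UT F m) where
  carrier := {M | ∀ i j, M.1 i j ≠ 0 → t i - t j = g}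
  add_mem' := fun {a b} ha hb i j h => by
    by_cases h0 : a.1 i j = 0
    · exact hb i j fun h1 => h (by simp [h0, h1])
    · exact ha i j h0
  zero_mem' := fun i j h => (h rfl).elim
  smul_mem' := fun c a ha i j h => ha i j fun h0 => h (by simp [h0])

/-- The homogeneous component of degree `g` of a matrix. -/
def elementaryProj (t : Fin m → G) (g : G) : UT F m →+ elementaryGrading F t g where
  toFun M := ⟨⟨fun i j => if t i - t j = g then M.1 i j else 0, fun i j hij => by
    simp [M.2 hij]⟩, fun i j h => by by_contra hne; exact h (if_neg hne)⟩
  map_zero' := by ext i j; simp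
  map_add' a b := by
    ext i j
    change (if t i - t j = g then a.1 i j + b.1 i j else 0) =
      (if t i - t j = g then a.1 i j else 0) + (if t i - t j = g then b.1 i j else 0)
    split_ifs <;> simp

instance elementaryGrading.gradedMonoid (t : Fin m → G) :
    SetLike.GradedMonoid (elementaryGrading F t) where
  one_mem i j h := by
    by_cases hij : i = j
    · simp [hij]
    · exact (h (Matrix.one_apply_ne hij)).elim
  mul_mem g h a b ha hb i j hne := by
    have hne' : ∑ k, a.1 i k * b.1 k j ≠ 0 := hne
    obtain ⟨k, -, hk⟩ := Finset.exists_ne_zero_of_sum_ne_zero hne'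
    rw [← ha i k (left_ne_zero_of_mul hk), ← hb k j (right_ne_zero_of_mul hk), sub_add_sub_cancel]

instance elementaryGrading.decomposition (t : Fin m → G) :
    DirectSum.Decomposition (elementaryGrading F t) :=
  DirectSum.Decomposition.ofAddHom (elementaryGrading F t)
    (∑ g ∈ Finset.univ.image fun p : Fin m × Fin m => t p.1 - t p.2,
      (DirectSum.of (fun g => elementaryGrading F t g) g).comp (elementaryProj F t g))
    (by
      ext M i j
      simp only [AddMonoidHom.comp_apply, AddMonoidHom.finsetSum_apply, map_sum,
        DirectSum.coeAddMonoidHom_of, AddMonoidHom.id_apply]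
      rw [AddSubmonoidClass.coe_finsetSum, Matrix.sum_apply]
      refine (Finset.sum_ite_eq _ (t i - t j) fun _ => M.1 i j).trans (if_pos ?_)
      exact Finset.mem_image.2 ⟨(i, j), Finset.mem_univ _, rfl⟩)
    (by
      refine DirectSum.addHom_ext fun g M => ?_
      simp only [AddMonoidHom.comp_apply, AddMonoidHom.finsetSum_apply,
        DirectSum.coeAddMonoidHom_of, AddMonoidHom.id_apply]
      have hself : elementaryProj F t g M.1 = M := by
        ext i j
        change (if t i - t j = g then M.1.1 i j else 0) = M.1.1 i j
        split_ifs with h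
        · rfl
        · by_contra h0
          exact h (M.2 i j (Ne.symm h0))
      rw [Finset.sum_eq_single g, hself]
      · intro g' _ hg
        have : elementaryProj F t g' M.1 = 0 := by
          ext i j
          change (if t i - t j = g' then M.1.1 i j else 0) = 0
          split_ifs with h
          · by_contra h0
            exact hg (h.symm.trans (M.2 i j h0))
          · rfl
        rw [this, map_zero]
      · intro hg
        have : M = 0 := by
          ext i j
          by_contra h0
          exact hg (Finset.mem_image.2 ⟨(i, j), Finset.mem_univ _, M.2 i j h0⟩)
        rw [this]
        simp)

instance elementaryGrading.gradedAlgebra (t : Fin m → G) :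
    GradedAlgebra (elementaryGrading F t) where

end Elementary

/-! ## The finest grading and the symplectic involution on `UT_{2r}(F)` -/

/-- The standard basis vector of `ℤ^r` with the (zero-based) entry `k` equal to `1`. -/
def stdVec (r k : ℕ) : Fin r → ℤ := fun l => if (l : ℕ) = k then 1 else 0

/-- The tuple `(e_1, …, e_r, 0, e_r - e_{r-1}, …, e_r - e_1)` of `2r` elements of `ℤ^r`
(the entry `0` is `e_r - e_r`). -/
def finestTuple (r : ℕ) (i : Fin (2 * r)) : Fin r → ℤ :=
  if (i : ℕ) < r then stdVec r i else stdVec r (r - 1) - stdVec r (2 * r - 1 - i)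

/-- The finest grading on `UT_{2r}(F)`. -/
abbrev finestGrading (F : Type*) [Field F] (r : ℕ) : (Fin r → ℤ) → Submodule F (UT F (2 * r)) :=
  elementaryGrading F (finestTuple r)

/-- The reflection `e_{ij} ↦ e_{m+1-j,m+1-i}` on `m × m` matrices. -/
def matrixReflection {F : Type*} {m : ℕ} (M : Matrix (Fin m) (Fin m) F) :
    Matrix (Fin m) (Fin m) F :=
  Matrix.of fun i j => M j.rev i.rev

/-- The diagonal matrix `D = diag(I_r, -I_r)`. -/
def symplecticD (F : Type*) [Field F] (r : ℕ) : Matrix (Fin (2 * r)) (Fin (2 * r)) F :=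
  Matrix.diagonal fun i => if (i : ℕ) < r then 1 else -1

theorem symplecticD_mul_self (F : Type*) [Field F] (r : ℕ) :
    symplecticD F r * symplecticD F r = 1 := by
  rw [symplecticD, Matrix.diagonal_mul_diagonal, ← Matrix.diagonal_one]
  congr 1
  ext i
  split_ifs <;> simp

theorem symplecticD_inv (F : Type*) [Field F] (r : ℕ) : (symplecticD F r)⁻¹ = symplecticD F r :=
  Matrix.inv_eq_left_inv (symplecticD_mul_self F r)

theorem symplectic_apply {F : Type*} [Field F] {r : ℕ} (M : Matrix (Fin (2 * r)) (Fin (2 * r)) F)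
    (i j : Fin (2 * r)) :
    (symplecticD F r * matrixReflection M * (symplecticD F r)⁻¹) i j =
      (if (i : ℕ) < r then 1 else -1) * M j.rev i.rev * (if (j : ℕ) < r then 1 else -1) := by
  rw [symplecticD_inv, symplecticD, Matrix.mul_diagonal, Matrix.diagonal_mul]
  rfl

theorem matrixReflection_mul {F : Type*} [Field F] {m : ℕ} (M N : Matrix (Fin m) (Fin m) F) :
    matrixReflection (M * N) = matrixReflection N * matrixReflection M := by
  ext i j
  simp only [matrixReflection, Matrix.of_apply, Matrix.mul_apply]
  rw [← Equiv.sum_comp Fin.revPerm]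
  exact Finset.sum_congr rfl fun k _ => mul_comm _ _

theorem finestTuple_add_rev {r : ℕ} (i : Fin (2 * r)) :
    finestTuple r i + finestTuple r i.rev = stdVec r (r - 1) := by
  have hi := i.2
  unfold finestTuple
  rw [Fin.val_rev]
  by_cases h : (i : ℕ) < r
  · rw [if_pos h, if_neg (by omega), show 2 * r - 1 - (2 * r - (i + 1)) = (i : ℕ) by omega]
    abel
  · rw [if_neg h, if_pos (by omega), show 2 * r - 1 - (i : ℕ) = 2 * r - (i + 1) by omega]
    abel

/-- The symplectic involution `M ↦ D M^∗ D⁻¹` on `UT_{2r}(F)`, as a graded involution for the finest grading. -/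
def symplecticInvolution (F : Type*) [Field F] (r : ℕ) :
    GradedInvolution (finestGrading F r) where
  toLinearMap :=
    { toFun := fun M => ⟨symplecticD F r * matrixReflection M.1 * (symplecticD F r)⁻¹, by
        intro i j hij
        rw [symplectic_apply, M.2 (show id i.rev < id j.rev from Fin.rev_lt_rev.2 hij)]
        simp⟩
      map_add' := fun M N => by
        ext i j
        change (symplecticD F r * matrixReflection (M.1 + N.1) * (symplecticD F r)⁻¹) i j =
          (symplecticD F r * matrixReflection M.1 * (symplecticD F r)⁻¹) i j +
          (symplecticD F r * matrixReflection N.1 * (symplecticD F r)⁻¹) i j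
        simp only [symplectic_apply, Matrix.add_apply]
        ring
      map_smul' := fun c M => by
        ext i j
        change (symplecticD F r * matrixReflection (c • M.1) * (symplecticD F r)⁻¹) i j =
          c * (symplecticD F r * matrixReflection M.1 * (symplecticD F r)⁻¹) i j
        simp only [symplectic_apply, Matrix.smul_apply, smul_eq_mul]
        ring }
  involutive := fun M => by
    ext i j
    change (symplecticD F r * matrixReflection
      (symplecticD F r * matrixReflection M.1 * (symplecticD F r)⁻¹) * (symplecticD F r)⁻¹) i j = _
    simp only [symplectic_apply, Fin.rev_rev, Fin.val_rev]
    have hi := i.2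
    have hj := j.2
    by_cases h1 : (i : ℕ) < r <;> by_cases h2 : (j : ℕ) < r
    · rw [if_pos h1, if_pos h2, if_neg (by omega), if_neg (by omega)]; ring
    · rw [if_pos h1, if_neg h2, if_pos (by omega), if_neg (by omega)]; ring
    · rw [if_neg h1, if_pos h2, if_neg (by omega), if_pos (by omega)]; ring
    · rw [if_neg h1, if_neg h2, if_pos (by omega), if_pos (by omega)]; ring
  map_mul := fun M N => by
    refine Subtype.ext ?_
    change symplecticD F r * matrixReflection (M.1 * N.1) * (symplecticD F r)⁻¹ =
      symplecticD F r * matrixReflection N.1 * (symplecticD F r)⁻¹ *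
        (symplecticD F r * matrixReflection M.1 * (symplecticD F r)⁻¹)
    have h : ∀ X : Matrix (Fin (2 * r)) (Fin (2 * r)) F,
        symplecticD F r * (symplecticD F r * X) = X := fun X => by
      rw [← Matrix.mul_assoc, symplecticD_mul_self, Matrix.one_mul]
    simp only [symplecticD_inv, matrixReflection_mul, Matrix.mul_assoc, h]
  map_mem := fun g M hM i j hne => by
    have hne' : (symplecticD F r * matrixReflection M.1 * (symplecticD F r)⁻¹) i j ≠ 0 := hne
    rw [symplectic_apply] at hne'
    have h := hM _ _ (right_ne_zero_of_mul (left_ne_zero_of_mul hne'))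
    rw [← h, sub_eq_sub_iff_add_eq_add, finestTuple_add_rev, add_comm, finestTuple_add_rev]

end

/-! Write `m = 2r`. Expanding a product of matrices entrywise, a monomial evaluates to a sum over
paths `x 0 ≤ … ≤ x n` in the `m` vertices. Each path contributes, up to sign, the matrix unit at its
endpoints times one entry of every variable, read at the position of its step, or at the reflected
position if the variable is starred. So evaluations are spanned by functions `coordFun c e`, where
`c` assigns a position to each variable.

A monotone path has at most `m - 1` jumps. With exactly `m - 1` it runs from the first vertex to the
last in unit steps, and `c` is full. Full assignments number `K * n.choose (m - 1) * m ^ (n - (m -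
1))`, with `K` independent of `n`; all others are `O(n ^ (m - 2) * m ^ n)`. This is the upper bound
(`evalSpace_le_span`).

Conversely, each full assignment comes from a path (`IsFull.exists_pathEntries`). In the finest
grading, degree zero means diagonal, so the degrees of the word reveal the jumps, hence the path,
and the word evaluates to a single `coordFun` up to sign (`coordFun_mem_evalSpace`). Substituting
matrix units shows these functions independent (`linearIndependent_coordFun`), so the two bounds
share their leading term. -/

noncomputable section

/-! ## Positions of matrix entries and paths -/

section Paths

variable {m n : ℕ} {ι : Type*}

/-- The position `(i, j)`, or its reflection `(m + 1 - j, m + 1 - i)`. -/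
def flipPair (b : Bool) (e : Fin m × Fin m) : Fin m × Fin m :=
  if b then (e.2.rev, e.1.rev) else e

theorem flipPair_fst_eq_snd (b : Bool) (e : Fin m × Fin m) :
    (flipPair b e).1 = (flipPair b e).2 ↔ e.1 = e.2 := by
  cases b <;> simp [flipPair, Fin.rev_inj, eq_comm]

theorem flipPair_fst_le_snd (b : Bool) (e : Fin m × Fin m) :
    (flipPair b e).1 ≤ (flipPair b e).2 ↔ e.1 ≤ e.2 := by
  cases b <;> simp [flipPair, Fin.rev_le_rev]

/-- The `t`-th position above the diagonal. -/
def superDiag (t : Fin (m - 1)) : Fin m × Fin m :=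
  (⟨t, by omega⟩, ⟨t + 1, by omega⟩)

/-- The assignments which use every position above the diagonal once, up to reflection, and
diagonal positions otherwise. -/
def IsFull (c : ι → Fin m × Fin m) : Prop :=
  ∃ u : Fin (m - 1) → ι, Function.Injective u ∧
    (∀ t, ∃ b, c (u t) = flipPair b (superDiag t)) ∧ ∀ i, i ∉ Set.range u → (c i).1 = (c i).2

/-- The set of indices which are assigned positions off the diagonal. -/
def offDiagSet [Fintype ι] (c : ι → Fin m × Fin m) : Finset ι :=
  Finset.univ.filter fun i => (c i).1 ≠ (c i).2

theorem mem_offDiagSet [Fintype ι] {c : ι → Fin m × Fin m} {i : ι} :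
    i ∈ offDiagSet c ↔ (c i).1 ≠ (c i).2 := by
  simp [offDiagSet]

/-- The positions of the entries collected along the path `x` by the word with permutation `σ`
and stars `δ`. -/
def pathEntries (σ : Equiv.Perm (Fin n)) (δ : Fin n → Bool) (x : Fin (n + 1) → Fin m) (i : Fin n) :
    Fin m × Fin m :=
  flipPair (δ (σ.symm i)) (x (σ.symm i).castSucc, x (σ.symm i).succ)

/-- The set of steps at which the path moves. -/
def jumps (x : Fin (n + 1) → Fin m) : Finset (Fin n) :=
  Finset.univ.filter fun k => x k.castSucc ≠ x k.succ

theorem mem_jumps {x : Fin (n + 1) → Fin m} {k : Fin n} :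
    k ∈ jumps x ↔ x k.castSucc ≠ x k.succ := by
  simp [jumps]

theorem card_offDiagSet_pathEntries (σ : Equiv.Perm (Fin n)) (δ : Fin n → Bool)
    (x : Fin (n + 1) → Fin m) : (offDiagSet (pathEntries σ δ x)).card = (jumps x).card := by
  refine Finset.card_equiv σ.symm fun i => ?_
  rw [mem_offDiagSet, mem_jumps, pathEntries, Ne, flipPair_fst_eq_snd]

theorem lt_succ_of_mem_jumps {x : Fin (n + 1) → Fin m} (hx : Monotone x) {k : Fin n}
    (hk : k ∈ jumps x) : x k.castSucc < x k.succ :=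
  lt_of_le_of_ne (hx k.castSucc_lt_succ.le) (mem_jumps.1 hk)

theorem lt_of_mem_jumps {x : Fin (n + 1) → Fin m} (hx : Monotone x) {k l : Fin n}
    (hk : k ∈ jumps x) (hkl : k < l) : x k.castSucc < x l.castSucc :=
  (lt_succ_of_mem_jumps hx hk).trans_le (hx (show k.succ ≤ l.castSucc from Nat.succ_le_of_lt hkl))

/-- A monotone path never returns to a vertex it has left. -/
theorem injOn_jumps {x : Fin (n + 1) → Fin m} (hx : Monotone x) :
    Set.InjOn (fun k : Fin n => (x k.castSucc : ℕ)) (jumps x) := by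
  intro k hk l hl h
  have h' : x k.castSucc = x l.castSucc := Fin.ext h
  rcases lt_trichotomy k l with hkl | hkl | hkl
  · exact absurd h' (lt_of_mem_jumps hx hk hkl).ne
  · exact hkl
  · exact absurd h'.symm (lt_of_mem_jumps hx hl hkl).ne

theorem mapsTo_jumps {x : Fin (n + 1) → Fin m} (hx : Monotone x) :
    Set.MapsTo (fun k : Fin n => (x k.castSucc : ℕ)) (jumps x) (Finset.range (m - 1)) := by
  intro k hk
  have h : (x k.castSucc : ℕ) < x k.succ := lt_succ_of_mem_jumps hx hk
  have := (x k.succ).2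
  simp only [Finset.coe_range, Set.mem_Iio]
  omega

theorem card_jumps_le {x : Fin (n + 1) → Fin m} (hx : Monotone x) : (jumps x).card ≤ m - 1 := by
  simpa using Finset.card_le_card_of_injOn _ (mapsTo_jumps hx) (injOn_jumps hx)

/-- Pigeonhole: the `m - 1` jumps leave distinct vertices below `m - 1`, so they leave all of them.
-/
theorem exists_jump {x : Fin (n + 1) → Fin m} (hx : Monotone x) (hc : (jumps x).card = m - 1)
    {t : ℕ} (ht : t < m - 1) : ∃ k ∈ jumps x, (x k.castSucc : ℕ) = t := by
  have := Finset.surjOn_of_injOn_of_card_le _ (mapsTo_jumps hx) (injOn_jumps hx) (by simp [hc])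
  obtain ⟨k, hk, h⟩ := this (by simpa using ht)
  exact ⟨k, hk, h⟩

/-- A longer jump would skip a vertex that some other jump has to leave. -/
theorem succ_of_mem_jumps {x : Fin (n + 1) → Fin m} (hx : Monotone x)
    (hc : (jumps x).card = m - 1) {k : Fin n} (hk : k ∈ jumps x) :
    (x k.succ : ℕ) = x k.castSucc + 1 := by
  have h1 : (x k.castSucc : ℕ) < x k.succ := lt_succ_of_mem_jumps hx hk
  have h2 := (x k.succ).2
  rcases Nat.lt_or_ge (x k.castSucc + 1) (m - 1) with h | h
  · obtain ⟨l, hl, hlt⟩ := exists_jump hx hc h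
    have hkl : k < l := by
      by_contra hlk
      have : x l.castSucc ≤ x k.castSucc := hx (show l.castSucc ≤ k.castSucc from not_lt.1 hlk)
      have : (x l.castSucc : ℕ) ≤ x k.castSucc := this
      omega
    have : (x k.succ : ℕ) ≤ x l.castSucc :=
      hx (show k.succ ≤ l.castSucc from Nat.succ_le_of_lt hkl)
    omega
  · omega

theorem zero_of_card_jumps (hm : 2 ≤ m) {x : Fin (n + 1) → Fin m} (hx : Monotone x)
    (hc : (jumps x).card = m - 1) : (x 0 : ℕ) = 0 := by
  obtain ⟨k, -, hk⟩ := exists_jump hx hc (show 0 < m - 1 by omega)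
  have : (x 0 : ℕ) ≤ x k.castSucc := hx (Fin.zero_le _)
  omega

theorem last_of_card_jumps (hm : 2 ≤ m) {x : Fin (n + 1) → Fin m} (hx : Monotone x)
    (hc : (jumps x).card = m - 1) : (x (Fin.last n) : ℕ) = m - 1 := by
  obtain ⟨k, hk, hk'⟩ := exists_jump hx hc (show m - 2 < m - 1 by omega)
  have h1 := succ_of_mem_jumps hx hc hk
  have h2 : (x k.succ : ℕ) ≤ x (Fin.last n) := hx (Fin.le_last _)
  have := (x (Fin.last n)).2
  omega

/-- Both paths start at `0` and move by one at each jump. This is what lets the degrees of a word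
determine the path. -/
theorem eq_of_jumps_eq (hm : 2 ≤ m) {x y : Fin (n + 1) → Fin m} (hx : Monotone x)
    (hy : Monotone y) (hc : (jumps x).card = m - 1) (h : jumps y = jumps x) : y = x := by
  have hc' : (jumps y).card = m - 1 := by rw [h, hc]
  funext k
  induction k using Fin.induction with
  | zero => exact Fin.ext ((zero_of_card_jumps hm hy hc').trans (zero_of_card_jumps hm hx hc).symm)
  | succ k ih =>
    by_cases hk : k ∈ jumps x
    · refine Fin.ext ?_
      rw [succ_of_mem_jumps hx hc hk, succ_of_mem_jumps hy hc' (h ▸ hk), ih]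
    · have hk' : k ∉ jumps y := h ▸ hk
      rw [mem_jumps, not_not] at hk hk'
      rw [← hk, ← hk', ih]

theorem isFull_pathEntries (σ : Equiv.Perm (Fin n)) (δ : Fin n → Bool) {x : Fin (n + 1) → Fin m}
    (hx : Monotone x) (hc : (jumps x).card = m - 1) : IsFull (pathEntries σ δ x) := by
  choose k hk hkt using fun t : Fin (m - 1) => exists_jump hx hc t.2
  refine ⟨fun t => σ (k t), fun s t hst => ?_, fun t => ⟨δ (k t), ?_⟩, fun i hi => ?_⟩
  · have := σ.injective hst
    exact Fin.ext (by rw [← hkt s, ← hkt t, this])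
  · rw [pathEntries, Equiv.symm_apply_apply]
    congr 1
    exact Prod.ext (Fin.ext (hkt t)) (Fin.ext ((succ_of_mem_jumps hx hc (hk t)).trans
      (congrArg (· + 1) (hkt t))))
  · rw [pathEntries, flipPair_fst_eq_snd]
    by_contra hne
    have hj : σ.symm i ∈ jumps x := mem_jumps.2 hne
    have hlt := mapsTo_jumps hx hj
    simp only [Finset.coe_range, Set.mem_Iio] at hlt
    refine hi ⟨⟨_, hlt⟩, ?_⟩
    have := injOn_jumps hx (hk ⟨_, hlt⟩) hj (hkt ⟨_, hlt⟩)
    simp [this]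

theorem superDiag_ne (t : Fin (m - 1)) : (superDiag t).1 ≠ (superDiag t).2 := by
  simp [superDiag]

theorem IsFull.fst_le_snd {c : ι → Fin m × Fin m} (hc : IsFull c) (i : ι) :
    (c i).1 ≤ (c i).2 := by
  obtain ⟨u, -, h1, h2⟩ := hc
  by_cases hi : i ∈ Set.range u
  · obtain ⟨t, rfl⟩ := hi
    obtain ⟨b, hb⟩ := h1 t
    rw [hb, flipPair_fst_le_snd]
    simp [superDiag, Fin.le_def]
  · exact (h2 i hi).le

theorem IsFull.fst_ne_snd_iff {c : ι → Fin m × Fin m} {u : Fin (m - 1) → ι}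
    (h1 : ∀ t, ∃ b, c (u t) = flipPair b (superDiag t))
    (h2 : ∀ i, i ∉ Set.range u → (c i).1 = (c i).2) (i : ι) :
    (c i).1 ≠ (c i).2 ↔ i ∈ Set.range u := by
  refine ⟨fun h => by_contra fun hn => h (h2 i hn), ?_⟩
  rintro ⟨t, rfl⟩
  obtain ⟨b, hb⟩ := h1 t
  rw [hb, Ne, flipPair_fst_eq_snd]
  exact superDiag_ne t

theorem IsFull.card_offDiagSet [Fintype ι] {c : ι → Fin m × Fin m} (hc : IsFull c) :
    (offDiagSet c).card = m - 1 := by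
  classical
  obtain ⟨u, hu, h1, h2⟩ := hc
  have : offDiagSet c = Finset.univ.image u := by
    ext i
    rw [mem_offDiagSet, IsFull.fst_ne_snd_iff h1 h2]
    simp
  rw [this, Finset.card_image_of_injective _ hu, Finset.card_univ, Fintype.card_fin]

/-- Every full assignment is collected by some word along a path with `m - 1` jumps: sort the
indices by the place at which their entries have to be read. -/
theorem IsFull.exists_pathEntries (hm : 2 ≤ m) {c : Fin n → Fin m × Fin m} (hc : IsFull c) :
    ∃ (σ : Equiv.Perm (Fin n)) (δ : Fin n → Bool) (x : Fin (n + 1) → Fin m),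
      Monotone x ∧ (jumps x).card = m - 1 ∧ pathEntries σ δ x = c := by
  classical
  have hcard := hc.card_offDiagSet
  obtain ⟨u, hu, h1, h2⟩ := hc
  choose b hb using h1
  -- Sorting keys: the jump from `t` to `t + 1` gets `2t + 1`, and a diagonal entry at vertex `p`
  -- gets `2p`, hence is read between the jumps into and out of `p`.
  obtain ⟨key, hkey⟩ : ∃ key : Fin n → ℕ, ∀ i, (∀ t, i = u t → key i = 2 * t + 1) ∧
      (i ∉ Set.range u → key i = 2 * (c i).1) := by
    refine ⟨fun i => if h : i ∈ Set.range u then 2 * (h.choose : ℕ) + 1 else 2 * (c i).1,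
      fun i => ⟨fun t ht => ?_, fun h => by simp only [dif_neg h]⟩⟩
    have h : i ∈ Set.range u := ⟨t, ht.symm⟩
    have : h.choose = t := hu (h.choose_spec.trans ht)
    simp only [dif_pos h, this]
  have hkeyu : ∀ t, key (u t) = 2 * t + 1 := fun t => (hkey _).1 t rfl
  set σ := Tuple.sort key with hσ
  have hmono : Monotone (key ∘ σ) := Tuple.monotone_sort key
  -- Odd keys occur only once, so the order around a jump does not depend on how the sort breaks
  -- ties.
  have hlt : ∀ t (k : Fin n), (σ.symm (u t) : ℕ) < k ↔ 2 * (t : ℕ) + 1 < key (σ k) := by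
    intro t k
    have hm1 := @hmono (σ.symm (u t)) k
    have hm2 := @hmono k (σ.symm (u t))
    simp only [Function.comp_apply, Equiv.apply_symm_apply, hkeyu, Fin.le_def] at hm1 hm2
    constructor
    · intro h
      refine lt_of_le_of_ne (hm1 h.le) fun heq => ?_
      by_cases hr : σ k ∈ Set.range u
      · obtain ⟨s, hs⟩ := hr
        rw [← hs, hkeyu] at heq
        have hst : s = t := Fin.ext (by omega)
        rw [← hst, hs] at h
        simp at h
      · rw [(hkey _).2 hr] at heq
        omega
    · intro h
      by_contra hn
      have := hm2 (by omega)
      omega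
  have hle : ∀ t (k : Fin n), (σ.symm (u t) : ℕ) < k + 1 ↔ 2 * (t : ℕ) + 1 ≤ key (σ k) := by
    intro t k
    have hm1 := @hmono (σ.symm (u t)) k
    simp only [Function.comp_apply, Equiv.apply_symm_apply, hkeyu, Fin.le_def] at hm1
    refine ⟨fun h => hm1 (by omega), fun h => ?_⟩
    rcases h.lt_or_eq with h | h
    · have := (hlt t k).2 h
      omega
    · by_cases hr : σ k ∈ Set.range u
      · obtain ⟨s, hs⟩ := hr
        rw [← hs, hkeyu] at h
        have hst : s = t := Fin.ext (by omega)
        rw [← hst, hs]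
        simp
      · rw [(hkey _).2 hr] at h
        omega
  -- `P k` counts the jumps read before time `k`; it is the vertex reached at that time.
  let P : ℕ → ℕ := fun k => (Finset.univ.filter fun t : Fin (m - 1) => (σ.symm (u t) : ℕ) < k).card
  have hP : ∀ k, P k < m := fun k => by
    have := (Finset.card_filter_le (Finset.univ : Finset (Fin (m - 1)))
      fun t => (σ.symm (u t) : ℕ) < k)
    rw [Finset.card_univ, Fintype.card_fin] at this
    have : P k ≤ m - 1 := this
    omega
  have hPmono : Monotone P := fun k l h => Finset.card_le_card fun t => by
    simp only [Finset.mem_filter, Finset.mem_univ, true_and]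
    omega
  have hcount : ∀ q, q ≤ m - 1 →
      (Finset.univ.filter fun t : Fin (m - 1) => (t : ℕ) < q).card = q := fun q hq => by
    rw [Fin.card_filter_val_lt, min_eq_right hq]
  have hPu : ∀ (k : Fin n) (t : Fin (m - 1)), σ k = u t → P k = t ∧ P (k + 1) = t + 1 := by
    intro k t hk
    have hkk : key (σ k) = 2 * t + 1 := by rw [hk, hkeyu]
    refine ⟨?_, ?_⟩
    · rw [← hcount t t.2.le]
      refine congrArg Finset.card (Finset.filter_congr fun s _ => ?_)
      rw [hlt, hkk]; omega
    · rw [← hcount (t + 1) t.2]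
      refine congrArg Finset.card (Finset.filter_congr fun s _ => ?_)
      rw [hle, hkk]; omega
  have hPd : ∀ k : Fin n, σ k ∉ Set.range u →
      P k = (c (σ k)).1 ∧ P (k + 1) = (c (σ k)).1 := by
    intro k hk
    have hkk := (hkey _).2 hk
    have hq : ((c (σ k)).1 : ℕ) ≤ m - 1 := by have := (c (σ k)).1.2; omega
    refine ⟨?_, ?_⟩
    · refine Eq.trans ?_ (hcount _ hq)
      refine congrArg Finset.card (Finset.filter_congr fun s _ => ?_)
      rw [hlt, hkk]; omega
    · refine Eq.trans ?_ (hcount _ hq)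
      refine congrArg Finset.card (Finset.filter_congr fun s _ => ?_)
      rw [hle, hkk]; omega
  let x : Fin (n + 1) → Fin m := fun k => ⟨P k, hP k⟩
  have hentries : pathEntries σ
      (fun k => if h : σ k ∈ Set.range u then b h.choose else false) x = c := by
    funext i
    by_cases h : i ∈ Set.range u
    · obtain ⟨t, rfl⟩ := h
      have hr : u t ∈ Set.range u := ⟨t, rfl⟩
      have ht : hr.choose = t := hu hr.choose_spec
      obtain ⟨e1, e2⟩ := hPu (σ.symm (u t)) t (by simp)
      simp only [pathEntries, Equiv.apply_symm_apply, dif_pos hr, ht, hb]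
      congr 1
      exact Prod.ext (Fin.ext e1) (Fin.ext e2)
    · obtain ⟨e1, e2⟩ := hPd (σ.symm i) (by simpa using h)
      rw [Equiv.apply_symm_apply] at e1 e2
      simp only [pathEntries, Equiv.apply_symm_apply, dif_neg h, flipPair]
      exact Prod.ext (Fin.ext e1) ((Fin.ext e2 : _ = (c i).1).trans (h2 i h))
  have hxm : Monotone x := fun k l h => hPmono h
  refine ⟨σ, _, x, hxm, ?_, hentries⟩
  rw [← card_offDiagSet_pathEntries σ _ x, hentries, hcard]

end Paths

/-! ## Counting assignments -/

section Counting

open Classical in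
/-- The finite set of full assignments on `n` indices. -/
def fullSet (m n : ℕ) : Finset (Fin n → Fin m × Fin m) :=
  Finset.univ.filter IsFull

theorem mem_fullSet {m n : ℕ} {c : Fin n → Fin m × Fin m} : c ∈ fullSet m n ↔ IsFull c := by
  simp [fullSet]

/-- The assignments with fewer than `m - 1` positions off the diagonal, together with an entry. -/
def lowSet (m n : ℕ) : Finset ((Fin n → Fin m × Fin m) × (Fin m × Fin m)) :=
  Finset.univ.filter fun c => (offDiagSet c.1).card ≤ m - 2

variable {m n : ℕ} {ι κ : Type*}

theorem IsFull.comp_equiv {c : ι → Fin m × Fin m} (hc : IsFull c) (e : κ ≃ ι) :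
    IsFull (c ∘ e) := by
  obtain ⟨u, hu, h1, h2⟩ := hc
  refine ⟨e.symm ∘ u, e.symm.injective.comp hu, fun t => ?_, fun i hi => h2 _ fun ⟨t, ht⟩ => ?_⟩
  · simpa using h1 t
  · exact hi ⟨t, by simp [ht]⟩

/-- Full assignments can be transported along equivalences. -/
def fullCongr (m : ℕ) (e : κ ≃ ι) :
    {c : ι → Fin m × Fin m // IsFull c} ≃ {c : κ → Fin m × Fin m // IsFull c} where
  toFun c := ⟨c.1 ∘ e, c.2.comp_equiv e⟩
  invFun c := ⟨c.1 ∘ e.symm, c.2.comp_equiv e.symm⟩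
  left_inv c := Subtype.ext (by funext i; simp)
  right_inv c := Subtype.ext (by funext i; simp)

/-- A full assignment with prescribed off-diagonal set `S` consists of a full assignment on `S`
and of diagonal positions on the complement. -/
def fullFiberEquiv [Fintype ι] [DecidableEq ι] (S : Finset ι) (hS : S.card = m - 1) :
    {c : ι → Fin m × Fin m // IsFull c ∧ offDiagSet c = S} ≃
      {d : S → Fin m × Fin m // IsFull d} × ({i // i ∉ S} → Fin m) where
  toFun c := (⟨fun i => c.1 i, by
      obtain ⟨c, ⟨u, hu, h1, h2⟩, rfl⟩ := c
      have hmem : ∀ t, u t ∈ offDiagSet c := fun t =>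
        mem_offDiagSet.2 ((IsFull.fst_ne_snd_iff h1 h2 _).2 ⟨t, rfl⟩)
      refine ⟨fun t => ⟨u t, hmem t⟩, fun s t h => hu (congrArg Subtype.val h), h1, ?_⟩
      rintro ⟨i, hi⟩ hn
      obtain ⟨t, ht⟩ := (IsFull.fst_ne_snd_iff h1 h2 i).1 (mem_offDiagSet.1 hi)
      exact (hn ⟨t, Subtype.ext ht⟩).elim⟩, fun i => (c.1 i).1)
  invFun p := ⟨fun i => if h : i ∈ S then p.1.1 ⟨i, h⟩ else (p.2 ⟨i, h⟩, p.2 ⟨i, h⟩), by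
    obtain ⟨⟨d, hd⟩, e⟩ := p
    have hcard := hd.card_offDiagSet
    obtain ⟨u, hu, h1, h2⟩ := hd
    have hfull : IsFull fun i => if h : i ∈ S then d ⟨i, h⟩ else (e ⟨i, h⟩, e ⟨i, h⟩) := by
      refine ⟨fun t => u t, fun s t h => hu (Subtype.ext h), fun t => ?_, fun i hi => ?_⟩
      · simpa using h1 t
      · by_cases h : i ∈ S
        · simp only [dif_pos h]
          exact h2 _ fun ⟨t, ht⟩ => hi ⟨t, by simp [ht]⟩
        · simp only [dif_neg h]
    -- Off-diagonal indices lie in `S`, and both sets have `m - 1` elements.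
    refine ⟨hfull, Finset.eq_of_subset_of_card_le (fun i hi => ?_)
      (by rw [hfull.card_offDiagSet, hS])⟩
    rw [mem_offDiagSet] at hi
    by_contra h
    simp [h] at hi⟩
  left_inv := by
    rintro ⟨c, hc, rfl⟩
    refine Subtype.ext (funext fun i => ?_)
    by_cases h : i ∈ offDiagSet c
    · simp only [dif_pos h]
    · simp only [dif_neg h]
      rw [mem_offDiagSet, not_not] at h
      exact Prod.ext rfl h
  right_inv := by
    rintro ⟨⟨d, hd⟩, e⟩
    refine Prod.ext (Subtype.ext (funext fun i => ?_)) (funext fun i => ?_)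
    · simp
    · simp [i.2]

/-- Choose the off-diagonal set `S`, a full assignment on `S`, and a vertex for each remaining
index. The middle factor depends only on the size of `S`; its value is never needed, only that it is
positive. -/
theorem card_fullSet (m n : ℕ) :
    (fullSet m n).card = n.choose (m - 1) * ((fullSet m (m - 1)).card * m ^ (n - (m - 1))) := by
  classical
  have hmaps : ∀ c ∈ fullSet m n, offDiagSet c ∈
      Finset.powersetCard (m - 1) (Finset.univ : Finset (Fin n)) := fun c hc =>
    Finset.mem_powersetCard.2 ⟨Finset.subset_univ _, (mem_fullSet.1 hc).card_offDiagSet⟩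
  rw [Finset.card_eq_sum_card_fiberwise hmaps, Finset.sum_const_nat, Finset.card_powersetCard,
    Finset.card_univ, Fintype.card_fin]
  intro S hS
  have hS := (Finset.mem_powersetCard.1 hS).2
  have e : Fin (m - 1) ≃ S := (Fintype.equivFinOfCardEq (by simp [hS])).symm
  have h1 : (Finset.filter (fun c => offDiagSet c = S) (fullSet m n)).card =
      Fintype.card {c : Fin n → Fin m × Fin m // IsFull c ∧ offDiagSet c = S} := by
    rw [Fintype.card_subtype, fullSet, Finset.filter_filter]
  have h2 : Fintype.card {i // i ∉ S} = n - (m - 1) := by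
    rw [Fintype.card_subtype_compl, Fintype.card_fin, Fintype.card_coe, hS]
  rw [h1, Fintype.card_congr (fullFiberEquiv S hS), Fintype.card_prod,
    Fintype.card_congr (fullCongr m e), Fintype.card_subtype, Fintype.card_fun, h2,
    Fintype.card_fin, fullSet]

theorem card_fullSet_pos (m : ℕ) : 0 < (fullSet m (m - 1)).card :=
  Finset.card_pos.2 ⟨superDiag, mem_fullSet.2
    ⟨id, Function.injective_id, fun _ => ⟨false, rfl⟩, fun i hi => (hi ⟨i, rfl⟩).elim⟩⟩

/-- Encodes a small set by a function on a fixed `Fin k`, so that such sets are bounded by `n ^ k`;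
unused slots are padded with `0`. -/
theorem exists_subset_range {k : ℕ} (hn : 1 ≤ n) (S : Finset (Fin n)) (hS : S.card ≤ k) :
    ∃ f : Fin k → Fin n, ∀ i ∈ S, i ∈ Set.range f := by
  refine ⟨fun t => if h : (t : ℕ) < S.card then S.equivFin.symm ⟨t, h⟩ else ⟨0, hn⟩,
    fun i hi => ⟨⟨S.equivFin ⟨i, hi⟩, (S.equivFin ⟨i, hi⟩).2.trans_le hS⟩, ?_⟩⟩
  simp

/-- Overcounting: the assignment is recovered from a list of `m - 2` indices containing the
off-diagonal ones, the positions at those indices, and a vertex for every index. -/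
theorem card_lowSet_le (hn : 1 ≤ n) :
    (lowSet m n).card ≤ (m * m) ^ (m - 2) * (m * m) * (n ^ (m - 2) * m ^ n) := by
  classical
  let T := ((Fin (m - 2) → Fin n) × (Fin (m - 2) → Fin m × Fin m) × (Fin n → Fin m)) ×
    (Fin m × Fin m)
  let φ : T → (Fin n → Fin m × Fin m) × (Fin m × Fin m) := fun p =>
    (fun i => if h : ∃ t, p.1.1 t = i then p.1.2.1 h.choose else (p.1.2.2 i, p.1.2.2 i), p.2)
  have hsub : lowSet m n ⊆ Finset.univ.image φ := by
    rintro ⟨c, p⟩ hc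
    obtain ⟨f, hf⟩ := exists_subset_range hn (offDiagSet c) (Finset.mem_filter.1 hc).2
    -- Repetitions in `f` are harmless: `c ∘ f` stores the same position at each of them.
    refine Finset.mem_image.2 ⟨((f, c ∘ f, fun i => (c i).1), p), Finset.mem_univ _,
      Prod.ext (funext fun i => ?_) rfl⟩
    by_cases h : ∃ t, f t = i
    · simp only [φ, dif_pos h, Function.comp_apply, h.choose_spec]
    · simp only [φ, dif_neg h]
      have : i ∉ offDiagSet c := fun hi => h (hf i hi)
      rw [mem_offDiagSet, not_not] at this
      exact Prod.ext rfl this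
  refine (Finset.card_le_card hsub).trans (Finset.card_image_le.trans (le_of_eq ?_))
  simp only [T, Finset.card_univ, Fintype.card_prod, Fintype.card_fun, Fintype.card_fin]
  ring

end Counting

/-! ## Asymptotics -/

section Asymptotic

/-- Since `n.choose (m - 1)` is asymptotic to `n ^ (m - 1) / (m - 1)!`, the common term dominates
the excess by a factor of order `n`. -/
theorem isEquivalent_of_card_bounds {m : ℕ} (hm : 2 ≤ m) {K B : ℕ} (hK : 0 < K) {c : ℕ → ℕ}
    (hlow : ∀ n, n.choose (m - 1) * (K * m ^ (n - (m - 1))) ≤ c n)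
    (hup : ∀ n, 1 ≤ n →
      c n ≤ n.choose (m - 1) * (K * m ^ (n - (m - 1))) + B * (n ^ (m - 2) * m ^ n)) :
    ∃ C : ℝ, 0 < C ∧ (fun n : ℕ => (c n : ℝ)) ~[atTop]
      fun n : ℕ => C * (n : ℝ) ^ (m - 1) * (m : ℝ) ^ n := by
  have hm0 : (0 : ℝ) < m := by exact_mod_cast (by omega : 0 < m)
  have hK0 : (0 : ℝ) < K := by exact_mod_cast hK
  set C : ℝ := K / ((m - 1).factorial * (m : ℝ) ^ (m - 1)) with hC
  have hC0 : 0 < C := by positivity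
  refine ⟨C, hC0, ?_⟩
  have hmain : (fun n : ℕ => (n.choose (m - 1) : ℝ) * (K * (m : ℝ) ^ (n - (m - 1)))) ~[atTop]
      fun n : ℕ => C * (n : ℝ) ^ (m - 1) * (m : ℝ) ^ n := by
    refine ((isEquivalent_choose (m - 1)).mul IsEquivalent.refl).trans
      (EventuallyEq.isEquivalent ?_)
    filter_upwards [eventually_ge_atTop (m - 1)] with n hn
    have : (m : ℝ) ^ n = (m : ℝ) ^ (n - (m - 1)) * (m : ℝ) ^ (m - 1) := by
      rw [← pow_add, Nat.sub_add_cancel hn]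
    simp only [Pi.mul_apply]
    rw [this, hC]
    field_simp
  have herr : (fun n : ℕ => (c n : ℝ) - (n.choose (m - 1) : ℝ) * (K * (m : ℝ) ^ (n - (m - 1))))
      =o[atTop] fun n : ℕ => C * (n : ℝ) ^ (m - 1) * (m : ℝ) ^ n := by
    have hO : (fun n : ℕ => (c n : ℝ) - (n.choose (m - 1) : ℝ) * (K * (m : ℝ) ^ (n - (m - 1))))
        =O[atTop] fun n : ℕ => (n : ℝ) ^ (m - 2) * (m : ℝ) ^ n := by
      refine IsBigO.of_bound B ?_
      filter_upwards [eventually_ge_atTop 1] with n hn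
      have h1 : (n.choose (m - 1) : ℝ) * (K * (m : ℝ) ^ (n - (m - 1))) ≤ c n := by
        exact_mod_cast hlow n
      have h2 : (c n : ℝ) ≤ n.choose (m - 1) * (K * (m : ℝ) ^ (n - (m - 1))) +
          B * ((n : ℝ) ^ (m - 2) * (m : ℝ) ^ n) := by
        exact_mod_cast hup n hn
      rw [Real.norm_of_nonneg (by linarith), Real.norm_of_nonneg (by positivity)]
      linarith
    refine hO.trans_isLittleO ?_
    have h1 : (fun n : ℕ => (1 : ℝ)) =o[atTop] fun n : ℕ => (n : ℝ) :=
      isLittleO_const_left.2 (Or.inr (tendsto_norm_atTop_atTop.comp tendsto_natCast_atTop_atTop))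
    have h2 := h1.mul_isBigO
      (isBigO_refl (fun n : ℕ => (n : ℝ) ^ (m - 2) * (m : ℝ) ^ n) atTop)
    have h3 := h2.const_mul_right hC0.ne'
    refine (h3.congr (fun n => one_mul _) fun n => ?_)
    rw [show m - 1 = (m - 2) + 1 by omega, pow_succ]
    ring
  have := hmain.add_isLittleO herr
  exact this.congr_left (Eventually.of_forall fun n => by simp)

/-- The `n`-th roots of the ratio, of `C` and of `n ^ k` all tend to `1`. -/
theorem tendsto_rpow_one_div_of_isEquivalent {c : ℕ → ℝ} {C b : ℝ} (hC : 0 < C) (hb : 0 < b)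
    {k : ℕ} (h : c ~[atTop] fun n : ℕ => C * (n : ℝ) ^ k * b ^ n) :
    Tendsto (fun n : ℕ => c n ^ (1 / (n : ℝ))) atTop (𝓝 b) := by
  have hne : ∀ᶠ n : ℕ in atTop, C * (n : ℝ) ^ k * b ^ n ≠ 0 := by
    filter_upwards [eventually_ge_atTop 1] with n hn
    have : (0 : ℝ) < n := by exact_mod_cast hn
    positivity
  have hrat := (isEquivalent_iff_tendsto_one hne).1 h
  have hinv : Tendsto (fun n : ℕ => 1 / (n : ℝ)) atTop (𝓝 0) := tendsto_one_div_atTop_nhds_zero_nat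
  have hnn : Tendsto (fun n : ℕ => (n : ℝ) ^ (1 / (n : ℝ))) atTop (𝓝 1) :=
    tendsto_rpow_div.comp tendsto_natCast_atTop_atTop
  have h1 := hrat.rpow hinv (Or.inl one_ne_zero)
  have h2 := (tendsto_const_nhds (x := C)).rpow hinv (Or.inl hC.ne')
  have h3 := ((h1.mul h2).mul (hnn.pow k)).mul_const b
  rw [Real.rpow_zero, Real.rpow_zero, one_pow, one_mul, one_mul, one_mul] at h3
  refine h3.congr' ?_
  have hpos : ∀ᶠ n : ℕ in atTop, 0 < (c / fun n : ℕ => C * (n : ℝ) ^ k * b ^ n) n :=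
    hrat.eventually (lt_mem_nhds one_pos)
  filter_upwards [eventually_ge_atTop 1, hpos, hne] with n hn hp hz
  have hn0 : (0 : ℝ) < n := by exact_mod_cast hn
  have hc : c n = (c / fun n : ℕ => C * (n : ℝ) ^ k * b ^ n) n * (C * (n : ℝ) ^ k * b ^ n) := by
    rw [Pi.div_apply, div_mul_cancel₀ _ hz]
  conv_rhs => rw [hc]
  rw [Real.mul_rpow hp.le (by positivity), Real.mul_rpow (by positivity) (by positivity),
    Real.mul_rpow hC.le (by positivity)]
  have e1 : ((n : ℝ) ^ k) ^ (1 / (n : ℝ)) = ((n : ℝ) ^ (1 / (n : ℝ))) ^ k := by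
    rw [← Real.rpow_natCast, ← Real.rpow_natCast, ← Real.rpow_mul hn0.le, ← Real.rpow_mul hn0.le,
      mul_comm]
  have e2 : (b ^ n) ^ (1 / (n : ℝ)) = b := by
    rw [one_div, Real.pow_rpow_inv_natCast hb.le (by omega)]
  rw [e1, e2]
  ring

end Asymptotic

/-! ## Evaluating words along paths -/

theorem Matrix.prod_ofFn_eq_sum_paths {R ι : Type*} [CommSemiring R] [Fintype ι] [DecidableEq ι]
    {n : ℕ} (M : Fin n → Matrix ι ι R) :
    (List.ofFn M).prod = ∑ x : Fin (n + 1) → ι,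
      Matrix.single (x 0) (x (Fin.last n)) (∏ k : Fin n, M k (x k.castSucc) (x k.succ)) := by
  induction n with
  | zero =>
    rw [List.ofFn_zero, List.prod_nil]
    refine Eq.trans ?_ (Equiv.sum_comp (Equiv.funUnique (Fin 1) ι).symm _)
    ext i j
    rw [Matrix.sum_apply]
    simp [Matrix.single_apply, Matrix.one_apply, ite_and]
  | succ n ih =>
    rw [List.ofFn_succ, List.prod_cons, ih, Finset.mul_sum]
    refine Eq.trans ?_ (Equiv.sum_comp (Fin.consEquiv fun _ => ι) _)
    rw [Fintype.sum_prod_type_right]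
    refine Finset.sum_congr rfl fun x _ => ?_
    ext i j
    rw [Matrix.sum_apply, Matrix.mul_apply]
    simp [Matrix.single_apply, Fin.consEquiv, Fin.prod_univ_succ, ite_and, -Fin.succ_last]

/-! ### Degrees of matrix units in the finest grading -/

section Degrees

variable {r : ℕ}

/-- The degree of the matrix unit at the given position. -/
def posDeg (e : Fin (2 * r) × Fin (2 * r)) : Fin r → ℤ :=
  finestTuple r e.1 - finestTuple r e.2

/-- Entries of the tuple at mirror places have constant sum, so reflection preserves degrees. -/
theorem posDeg_flipPair (b : Bool) (e : Fin (2 * r) × Fin (2 * r)) :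
    posDeg (flipPair b e) = posDeg e := by
  cases b
  · rfl
  · change finestTuple r e.2.rev - finestTuple r e.1.rev = finestTuple r e.1 - finestTuple r e.2
    rw [sub_eq_sub_iff_add_eq_add, finestTuple_add_rev, add_comm, finestTuple_add_rev]

theorem sum_stdVec {k : ℕ} (hk : k < r) : ∑ l, stdVec r k l = 1 := by
  rw [Finset.sum_eq_single ⟨k, hk⟩]
  · simp [stdVec]
  · intro l _ hl
    exact if_neg fun h => hl (Fin.ext h)
  · simp

theorem stdVec_inj {k l : ℕ} (hk : k < r) (h : stdVec r k = stdVec r l) : k = l := by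
  by_contra hkl
  have := congrFun h ⟨k, hk⟩
  simp [stdVec, hkl] at this

/-- The coordinate sum is `1` on the first half of the tuple and `0` on the second; within a half,
the basis vectors differ. -/
theorem finestTuple_injective (r : ℕ) : Function.Injective (finestTuple r) := by
  have key : ∀ i j : Fin (2 * r), (i : ℕ) < r → ¬(j : ℕ) < r → finestTuple r i ≠ finestTuple r j := by
    intro i j hi hj h
    have hj2 := j.2
    have := congrArg (fun v : Fin r → ℤ => ∑ l, v l) h
    simp only [finestTuple, if_pos hi, if_neg hj, Pi.sub_apply, Finset.sum_sub_distrib] at this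
    rw [sum_stdVec hi, sum_stdVec (by omega), sum_stdVec (by omega)] at this
    omega
  intro i j h
  have hi2 := i.2
  have hj2 := j.2
  by_cases hi : (i : ℕ) < r <;> by_cases hj : (j : ℕ) < r
  · simp only [finestTuple, if_pos hi, if_pos hj] at h
    exact Fin.ext (stdVec_inj hi h)
  · exact (key i j hi hj h).elim
  · exact (key j i hj hi h.symm).elim
  · simp only [finestTuple, if_neg hi, if_neg hj, sub_right_inj] at h
    have := stdVec_inj (by omega) h
    exact Fin.ext (by omega)

theorem posDeg_eq_zero_iff (e : Fin (2 * r) × Fin (2 * r)) : posDeg e = 0 ↔ e.1 = e.2 := by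
  rw [posDeg, sub_eq_zero, (finestTuple_injective r).eq_iff]

end Degrees

/-! ### Monomials as sums over paths -/

section Words

variable (F : Type*) [Field F] (r : ℕ)

/-- The substitutions `x_{i,g} ↦ a i g` by homogeneous elements of `UT_{2r}(F)`. -/
abbrev GradedSubst : Type _ :=
  {a : ℕ → (Fin r → ℤ) → UT F (2 * r) // ∀ i g, a i g ∈ finestGrading F r g}

/-- The evaluation of a polynomial under all graded substitutions. -/
def evalMap : FreeStarAlgebra F (Fin r → ℤ) →ₗ[F]
    (GradedSubst F r → Matrix (Fin (2 * r)) (Fin (2 * r)) F) where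
  toFun f a := (starEval (symplecticInvolution F r) a.1 f).1
  map_add' f h := by ext a i j; simp
  map_smul' c f := by ext a i j; simp

/-- The sign with which the involution moves a matrix entry to the given position. -/
def flipSign (b : Bool) (e : Fin (2 * r) × Fin (2 * r)) : F :=
  if b then (if (e.1 : ℕ) < r then 1 else -1) * (if (e.2 : ℕ) < r then 1 else -1) else 1

/-- The matrix unit at the position `e`, multiplied by the product of the entries at the positions
`c i` of the variables. -/
def coordFun {n : ℕ} (c : Fin n → Fin (2 * r) × Fin (2 * r)) (e : Fin (2 * r) × Fin (2 * r)) :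
    GradedSubst F r → Matrix (Fin (2 * r)) (Fin (2 * r)) F := fun a =>
  Matrix.single e.1 e.2 (∏ i : Fin n, (a.1 i (posDeg (c i))).1 (c i).1 (c i).2)

/-- The monomial `x_{σ(1),g_1}^{δ_1} ⋯ x_{σ(n),g_n}^{δ_n}`. -/
def word {n : ℕ} (σ : Equiv.Perm (Fin n)) (g : Fin n → Fin r → ℤ) (δ : Fin n → Bool) :
    FreeStarAlgebra F (Fin r → ℤ) :=
  (List.ofFn fun k => FreeAlgebra.ι F (⟨(σ k : ℕ), g k, δ k⟩ : StarVar (Fin r → ℤ))).prod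

variable {F r}

theorem flipSign_ne_zero (b : Bool) (e : Fin (2 * r) × Fin (2 * r)) : flipSign F r b e ≠ 0 := by
  unfold flipSign
  split_ifs <;> simp

theorem star_entry (b : Bool) (M : UT F (2 * r)) (i j : Fin (2 * r)) :
    (if b then (symplecticInvolution F r).toLinearMap M else M).1 i j =
      flipSign F r b (i, j) * M.1 (flipPair b (i, j)).1 (flipPair b (i, j)).2 := by
  cases b
  · simp [flipSign, flipPair]
  · simp only [if_true, flipSign, flipPair]
    refine (symplectic_apply M.1 i j).trans ?_
    ring

theorem evalMap_word {n : ℕ} (σ : Equiv.Perm (Fin n)) (g : Fin n → Fin r → ℤ) (δ : Fin n → Bool)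
    (a : GradedSubst F r) :
    evalMap F r (word F r σ g δ) a = (List.ofFn fun k =>
      (if δ k then (symplecticInvolution F r).toLinearMap (a.1 (σ k) (g k))
        else a.1 (σ k) (g k)).1).prod := by
  change (UT F (2 * r)).val (starEval (symplecticInvolution F r) a.1 (word F r σ g δ)) = _
  rw [word, map_list_prod, map_list_prod, List.map_ofFn, List.map_ofFn]
  congr 2
  funext k
  simp [starEval]

open Classical in
/-- The paths compatible with the degrees of a word. -/
def admPaths {n : ℕ} (g : Fin n → Fin r → ℤ) : Finset (Fin (n + 1) → Fin (2 * r)) :=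
  Finset.univ.filter fun x => Monotone x ∧ ∀ k, posDeg (x k.castSucc, x k.succ) = g k

theorem mem_admPaths {n : ℕ} {g : Fin n → Fin r → ℤ} {x : Fin (n + 1) → Fin (2 * r)} :
    x ∈ admPaths g ↔ Monotone x ∧ ∀ k, posDeg (x k.castSucc, x k.succ) = g k := by
  simp [admPaths]

/-- Triangularity kills the paths that are not monotone, and homogeneity those with a step of the
wrong degree. -/
theorem evalMap_word_eq_sum {n : ℕ} (σ : Equiv.Perm (Fin n)) (g : Fin n → Fin r → ℤ)
    (δ : Fin n → Bool) :
    evalMap F r (word F r σ g δ) = ∑ x ∈ admPaths g,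
      (∏ k, flipSign F r (δ k) (x k.castSucc, x k.succ)) •
        coordFun F r (pathEntries σ δ x) (x 0, x (Fin.last n)) := by
  funext a
  rw [evalMap_word, Matrix.prod_ofFn_eq_sum_paths, Finset.sum_apply]
  symm
  refine (Finset.sum_subset_zero_on_sdiff (Finset.subset_univ _) (fun x hx => ?_)
    (fun x hx => ?_))
  · rw [Finset.mem_sdiff, mem_admPaths] at hx
    suffices h : ∃ k : Fin n, (if δ k then (symplecticInvolution F r).toLinearMap (a.1 (σ k) (g k))
        else a.1 (σ k) (g k)).1 (x k.castSucc) (x k.succ) = 0 by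
      obtain ⟨k, hk⟩ := h
      rw [Finset.prod_eq_zero (Finset.mem_univ k) hk, Matrix.single_zero]
    by_contra! hne
    refine hx.2 ⟨Fin.monotone_iff_le_succ.2 fun k => ?_, fun k => ?_⟩
    · by_contra hlt
      exact hne k ((if δ k then (symplecticInvolution F r).toLinearMap (a.1 (σ k) (g k))
        else a.1 (σ k) (g k)).2 (not_le.1 hlt))
    · have := hne k
      rw [star_entry] at this
      have h := a.2 (σ k) (g k) _ _ (right_ne_zero_of_mul this)
      exact (posDeg_flipPair (δ k) _).symm.trans h
  · have hx := (mem_admPaths.1 hx).2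
    -- The product over variables is reindexed by `σ` as a product over steps.
    rw [Pi.smul_apply, coordFun, Matrix.smul_single, smul_eq_mul,
      ← Equiv.prod_comp σ fun i : Fin n => (a.1 i (posDeg (pathEntries σ δ x i))).1
        (pathEntries σ δ x i).1 (pathEntries σ δ x i).2,
      ← Finset.prod_mul_distrib]
    congr 1
    refine Finset.prod_congr rfl fun k _ => ?_
    rw [star_entry, pathEntries, Equiv.symm_apply_apply, posDeg_flipPair, hx k]

end Words

/-! ## The codimensions -/

section Codimensions

variable (F : Type*) [Field F] (r : ℕ)

/-- The space of all evaluations of multilinear polynomials. -/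
def evalSpace (n : ℕ) :
    Submodule F (GradedSubst F r → Matrix (Fin (2 * r)) (Fin (2 * r)) F) :=
  (multilinearPart F (Fin r → ℤ) n).map (evalMap F r)

/-- The relatively free multilinear part is isomorphic to the space of evaluations. -/
def relMultilinearEquiv (n : ℕ) :
    relMultilinear (symplecticInvolution F r) n ≃ₗ[F] evalSpace F r n :=
  -- The identities are exactly the kernel of `evalMap`.
  (Submodule.quotEquivOfEq _ _ (by
      ext f
      rw [LinearMap.mem_ker, funext_iff]
      exact ⟨fun h a => congrArg Subtype.val (h a.1 a.2),
        fun h a ha => Subtype.ext (h ⟨a, ha⟩)⟩)).trans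
    ((((evalMap F r).domRestrict (multilinearPart F (Fin r → ℤ) n)).quotKerEquivRange).trans
      (LinearEquiv.ofEq _ _ (by rw [evalSpace, LinearMap.range_domRestrict])))

open Classical in
/-- The evaluations whose span contains the evaluations of all multilinear polynomials. -/
def spanningSet (n : ℕ) :
    Finset (GradedSubst F r → Matrix (Fin (2 * r)) (Fin (2 * r)) F) :=
  (Finset.univ.filter fun e : Fin (2 * r) × Fin (2 * r) =>
      (e.1 : ℕ) = 0 ∧ (e.2 : ℕ) = 2 * r - 1).biUnion
    (fun e => (fullSet (2 * r) n).image fun c => coordFun F r c e) ∪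
  (lowSet (2 * r) n).image fun p => coordFun F r p.1 p.2

variable {F r}

/-- At most one position joins the first vertex to the last, so each full assignment counts once;
this keeps the leading coefficient sharp. -/
theorem card_spanningSet_le (n : ℕ) :
    (spanningSet F r n).card ≤ (fullSet (2 * r) n).card + (lowSet (2 * r) n).card := by
  classical
  refine (Finset.card_union_le _ _).trans (add_le_add ?_ Finset.card_image_le)
  refine (Finset.card_biUnion_le_card_mul _ _ (fullSet (2 * r) n).card
    fun e _ => Finset.card_image_le).trans ?_
  refine (Nat.mul_le_mul_right _ (Finset.card_le_one.2 fun e he f hf => ?_)).trans (one_mul _).le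
  simp only [Finset.mem_filter, Finset.mem_univ, true_and] at he hf
  exact Prod.ext (Fin.ext (he.1.trans hf.1.symm)) (Fin.ext (he.2.trans hf.2.symm))

theorem evalSpace_le_span (hr : 1 ≤ r) (n : ℕ) :
    evalSpace F r n ≤ Submodule.span F (spanningSet F r n : Set _) := by
  classical
  rw [evalSpace, multilinearPart, Submodule.map_span, Submodule.span_le]
  rintro _ ⟨_, ⟨σ, g, δ, rfl⟩, rfl⟩
  change evalMap F r (word F r σ g δ) ∈ _
  rw [evalMap_word_eq_sum]
  refine Submodule.sum_mem _ fun x hx => Submodule.smul_mem _ _ (Submodule.subset_span ?_)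
  have hx := (mem_admPaths.1 hx).1
  rw [Finset.mem_coe, spanningSet, Finset.mem_union, Finset.mem_biUnion, Finset.mem_image]
  rcases (card_jumps_le hx).lt_or_eq with h | h
  · refine Or.inr ⟨(pathEntries σ δ x, (x 0, x (Fin.last n))),
      Finset.mem_filter.2 ⟨Finset.mem_univ _, ?_⟩, rfl⟩
    rw [card_offDiagSet_pathEntries]
    omega
  · refine Or.inl ⟨(x 0, x (Fin.last n)), Finset.mem_filter.2 ⟨Finset.mem_univ _,
      zero_of_card_jumps (by omega) hx h, last_of_card_jumps (by omega) hx h⟩,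
      Finset.mem_image.2 ⟨_, mem_fullSet.2 (isFull_pathEntries σ δ hx h), rfl⟩⟩

/-- Give the word the degrees of the path. Degree zero marks exactly the steps without a jump, so
any admissible path has the same jumps and is the same path; a single term survives, with
coefficient a nonzero sign. -/
theorem coordFun_mem_evalSpace (hr : 1 ≤ r) {n : ℕ} {c : Fin n → Fin (2 * r) × Fin (2 * r)}
    (hc : IsFull c) :
    coordFun F r c (⟨0, by omega⟩, ⟨2 * r - 1, by omega⟩) ∈ evalSpace F r n := by
  obtain ⟨σ, δ, x, hx, hj, rfl⟩ := hc.exists_pathEntries (by omega)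
  set g : Fin n → Fin r → ℤ := fun k => posDeg (x k.castSucc, x k.succ) with hg
  have hadm : admPaths g = {x} := by
    ext y
    rw [mem_admPaths, Finset.mem_singleton]
    constructor
    · rintro ⟨hy, hyg⟩
      refine eq_of_jumps_eq (by omega) hx hy hj (Finset.ext fun k => ?_)
      rw [mem_jumps, mem_jumps, not_iff_not]
      have h : posDeg (y k.castSucc, y k.succ) = posDeg (x k.castSucc, x k.succ) := hyg k
      rw [← posDeg_eq_zero_iff (y k.castSucc, y k.succ), h, posDeg_eq_zero_iff]
    · rintro rfl
      exact ⟨hx, fun k => rfl⟩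
  have hmem : evalMap F r (word F r σ g δ) ∈ evalSpace F r n :=
    Submodule.mem_map_of_mem (Submodule.subset_span ⟨σ, g, δ, rfl⟩)
  rw [evalMap_word_eq_sum, hadm, Finset.sum_singleton] at hmem
  have h0 : x 0 = ⟨0, by omega⟩ := Fin.ext (zero_of_card_jumps (by omega) hx hj)
  have h1 : x (Fin.last n) = ⟨2 * r - 1, by omega⟩ :=
    Fin.ext (last_of_card_jumps (by omega) hx hj)
  rw [h0, h1] at hmem
  exact (Submodule.smul_mem_iff _
    (Finset.prod_ne_zero_iff.2 fun k _ => flipSign_ne_zero _ _)).1 hmem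

/-- The substitution of the matrix unit at position `c i` for the variable with index `i`. -/
def unitSubst (F : Type*) [Field F] {n : ℕ} (c : Fin n → Fin (2 * r) × Fin (2 * r))
    (hc : ∀ i, (c i).1 ≤ (c i).2) : GradedSubst F r :=
  ⟨fun i g => ⟨Matrix.of fun p q =>
      if ∃ k : Fin n, (k : ℕ) = i ∧ c k = (p, q) ∧ posDeg (c k) = g then 1 else 0, by
      intro p q hpq
      refine if_neg ?_
      rintro ⟨k, -, hk, -⟩
      have := hc k
      rw [hk] at this
      exact absurd hpq (not_lt.2 this)⟩, by
    intro i g p q hne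
    obtain ⟨k, -, hk, hd⟩ := (ite_ne_right_iff.1 hne).1
    rw [← hd, hk]
    rfl⟩

theorem coordFun_unitSubst {n : ℕ} {c d : Fin n → Fin (2 * r) × Fin (2 * r)}
    (hd : ∀ i, (d i).1 ≤ (d i).2) (e : Fin (2 * r) × Fin (2 * r)) :
    coordFun F r c e (unitSubst F d hd) e.1 e.2 = if c = d then 1 else 0 := by
  rw [coordFun, Matrix.single_apply_same]
  have hval : ∀ i : Fin n, ((unitSubst F d hd).1 i (posDeg (c i))).1 (c i).1 (c i).2 =
      if d i = c i then 1 else 0 := by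
    intro i
    refine if_congr ⟨?_, fun h => ⟨i, rfl, h, congrArg posDeg h⟩⟩ rfl rfl
    rintro ⟨k, hk, h, -⟩
    rwa [Fin.ext hk] at h
  simp only [hval]
  split_ifs with h
  · subst h
    simp
  · obtain ⟨i, hi⟩ := Function.ne_iff.1 h
    exact Finset.prod_eq_zero (Finset.mem_univ i) (if_neg fun h' => hi h'.symm)

/-- The substitutions `unitSubst` form a dual family, so the argument works over every field, finite
ones included. -/
theorem linearIndependent_coordFun {n : ℕ} (e : Fin (2 * r) × Fin (2 * r)) :
    LinearIndependent F fun c : fullSet (2 * r) n => coordFun F r c.1 e := by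
  rw [Fintype.linearIndependent_iff]
  intro w hw d
  have := congrFun (congrFun (congrFun hw
    (unitSubst F d.1 (mem_fullSet.1 d.2).fst_le_snd)) e.1) e.2
  rw [Finset.sum_apply, Matrix.sum_apply] at this
  simpa [coordFun_unitSubst, Subtype.coe_inj] using this

theorem finite_span_spanningSet (n : ℕ) :
    Module.Finite F (Submodule.span F
      (spanningSet F r n : Set (GradedSubst F r → Matrix (Fin (2 * r)) (Fin (2 * r)) F))) :=
  FiniteDimensional.span_of_finite F (spanningSet F r n).finite_toSet

theorem finite_evalSpace (hr : 1 ≤ r) (n : ℕ) : Module.Finite F (evalSpace F r n) := by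
  have := finite_span_spanningSet (F := F) (r := r) n
  exact Submodule.finiteDimensional_of_le (evalSpace_le_span hr n)

theorem finite_relMultilinear (hr : 1 ≤ r) (n : ℕ) :
    Module.Finite F (relMultilinear (symplecticInvolution F r) n) := by
  have := finite_evalSpace (F := F) hr n
  exact Module.Finite.equiv (relMultilinearEquiv F r n).symm

theorem starCodim_eq (n : ℕ) :
    starCodim (symplecticInvolution F r) n = Module.finrank F (evalSpace F r n) :=
  (relMultilinearEquiv F r n).finrank_eq

theorem starCodim_le (hr : 1 ≤ r) (n : ℕ) : starCodim (symplecticInvolution F r) n ≤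
    (fullSet (2 * r) n).card + (lowSet (2 * r) n).card := by
  have := finite_span_spanningSet (F := F) (r := r) n
  rw [starCodim_eq]
  exact (Submodule.finrank_mono (evalSpace_le_span hr n)).trans
    ((finrank_span_finset_le_card _).trans (card_spanningSet_le n))

theorem card_fullSet_le_starCodim (hr : 1 ≤ r) (n : ℕ) :
    (fullSet (2 * r) n).card ≤ starCodim (symplecticInvolution F r) n := by
  have := finite_evalSpace (F := F) hr n
  rw [starCodim_eq]
  have h : LinearIndependent F fun c : fullSet (2 * r) n =>
      (⟨_, coordFun_mem_evalSpace hr (mem_fullSet.1 c.2)⟩ : evalSpace F r n) :=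
    LinearIndependent.of_comp (evalSpace F r n).subtype (linearIndependent_coordFun _)
  simpa using h.fintype_card_le_finrank

end Codimensions

theorem mainTheorem8 {F : Type*} [Field F] (r : ℕ) (hr : 1 ≤ r) :
    (∀ n : ℕ, Module.Finite F (relMultilinear (symplecticInvolution F r) n)) ∧
    (∃ C : ℝ, 0 < C ∧
      (fun n : ℕ => (starCodim (symplecticInvolution F r) n : ℝ)) ~[atTop]
        fun n : ℕ => C * (n : ℝ) ^ (2 * r - 1) * (2 * r : ℝ) ^ n) ∧
    HasStarExponent (symplecticInvolution F r) (2 * r : ℝ) := by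
  -- Here `K` is the number of full assignments on `m - 1` indices, and `B` is the factor
  -- independent of `n` in `card_lowSet_le`.
  have hasymp := isEquivalent_of_card_bounds (m := 2 * r) (by omega) (card_fullSet_pos (2 * r))
    (c := starCodim (symplecticInvolution F r))
    (fun n => card_fullSet (2 * r) n ▸ card_fullSet_le_starCodim hr n)
    (fun n hn => card_fullSet (2 * r) n ▸ (starCodim_le hr n).trans
      (Nat.add_le_add_left (card_lowSet_le hn) _))
  push_cast at hasymp
  refine ⟨finite_relMultilinear hr, hasymp, ?_⟩
  obtain ⟨C, hC, h⟩ := hasymp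
  have hr0 : (0 : ℝ) < r := by exact_mod_cast hr
  exact tendsto_rpow_one_div_of_isEquivalent hC (by positivity) h

end
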